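/- **Graphs.** Let $\mathbb{A}$ be a set of edge labels with arities, and let $\mathbb{A}^{\mathfrak d}=\mathbb{A}\cup\{\mathfrak d\}$ with a further binary label $\mathfrak d$. A c-graph $G$ (of type $0$) consists of finite sets $V_G$ of vertices and $E_G$ of edges, where each edge $e$ has a label $\mathrm{lab}_G(e)$ and a sequence $\mathrm{edg}_G(e)$ of attached vertices, whose length is the arity of the label. It is simple if distinct edges with the same label have different sequences of attached vertices. $G|_{\mathbb{A}}$ is obtained from $G$ by deleting all $\mathfrak d$-labelled edges. The tree-width $\mathrm{tw}(G)$ is the least width of a tree decomposition of $G$ (a finite tree with bags of vertices, such that the vertices attached to an edge are together in some bag and the nodes whose bags contain a given vertex form a non-empty connected set; the width is the maximal bag size minus one, or $0$ if all bags are empty). For a set $\mathcal G$ of c-graphs, $\mathrm{tw}(\mathcal G)=\sup_{G\in\mathcal G}\mathrm{tw}(G)\in\mathbb{N}\cup\{\infty\}$. **Fusion bound.** Let $G$ be a c-graph over $\mathbb{A}^{\mathfrak d}$. An equivalence relation $\approx$ on $V_G$ is compatible with $G$ if (1) no two distinct edges with the same label in $\mathbb{A}$ have componentwise $\approx$-equivalent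 sequences of attached vertices, and (2) $v_1\not\approx v_2$ for each $\mathfrak d$-labelled edge attached to $\langle v_1,v_2\rangle$. The quotient $G_{/\approx}$ has the $\approx$-classes as vertices, and the edges and labels of $G$, attached to the classes of the vertices to which they were attached. The relation $\approx$ is $k$-generated if $k$ is the least cardinality of a set of pairs such that $\approx$ is the least equivalence relation containing it. The fusion bound $\mathrm{fb}(G)$ is the maximal $k$ such that some equivalence relation compatible with $G$ is $k$-generated, and $\mathrm{fb}(\mathcal G)=\sup_{G\in\mathcal G}\mathrm{fb}(G)\in\mathbb{N}\cup\{\infty\}$. **Logic.** A qpf formula is a separating conjunction of atoms $x=y$, $x\neq y$ and $\mathsf r(x_1,\ldots,x_n)$, with $\mathsf r\in\mathbb{A}$ of arity $n$. A SID $\Delta$ is a set of rules $\mathsf B_0(x_1,\ldots,x_n)\leftarrow\exists y_1\ldots\exists y_m\,.\,\psi * \mathsf B_1(\mathbf z_1)*\cdots*\mathsf B_k(\mathbf z_k)$, where $\psi$ is a qpf formula, the $\mathsf B_i$ are predicates, and all variables are among the $x_i$ and $y_j$. An atom $x=y$ (resp. $x\neq y$) holds under a store (assignment of vertices to variables) $\mathfrak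 s$ in a c-graph without edges if $\mathfrak s(x)=\mathfrak s(y)$ (resp. $\mathfrak s(x)\neq\mathfrak s(y)$), the atom $\mathsf r(x_1,\ldots,x_n)$ holds in a c-graph whose only edge is labelled by $\mathsf r$ and attached to $\langle\mathfrak s(x_1),\ldots,\mathfrak s(x_n)\rangle$, and a separating conjunction holds in a simple c-graph if its edges can be split into disjoint parts, one for each conjunct, in which the conjuncts hold (vertices may be shared). A predicate atom holds if the right-hand side of some rule for the predicate, instantiated with its arguments, holds for some values of the existential variables (least such interpretation). In all models the vertices are exactly the values of the variables of the formula, resp. of the unfolding. For a nullary predicate $\mathsf A$, let $[\![\mathsf A]\!]_\Delta$ be the set of simple c-graphs over $\mathbb{A}$ that satisfy $\mathsf A$. **Rich canonical models.** A parse tree $T$ for $\mathsf A$ is a tree of rules of $\Delta$ that describes a complete unfolding of $\mathsf A$; its characteristic formula $\Theta(T)$ is the qpf formula that is the separating conjunction of all atoms $x=y$, $x\ne y$, $\mathsf r(\ldots)$ of the unfolding, with a fresh copy of the existential variables of a rule for each of its occurrences and with the formal parameters replaced by the actual ones. A store $\mathfrak s$ is canonical for $\Theta(T)$ if $\mathfrak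 s(x)=\mathfrak s(y)$ only if $x=y$ is a logical consequence of $\Theta(T)$, for all variables $x,y$. A rich canonical $\Delta$-model of $\mathsf A$ is a simple c-graph $G$ over $\mathbb{A}^{\mathfrak d}$ for which there are a parse tree $T$ for $\mathsf A$ and a store $\mathfrak s$ canonical for $\Theta(T)$ such that $G|_{\mathbb{A}}$ satisfies $\Theta(T)$ under $\mathfrak s$ and, for all $u,v\in V_G$, there is a $\mathfrak d$-labelled edge attached to $\langle u,v\rangle$ iff $x\neq y$ occurs in $\Theta(T)$ for some variables $x,y$ with $\mathfrak s(x)=u$ and $\mathfrak s(y)=v$. Let $[\![\mathsf A]\!]^{rc}_\Delta$ be the set of these. **Statement.** For each SID $\Delta$ and nullary predicate $\mathsf A$: $$\mathrm{tw}([\![\mathsf A]\!]_\Delta)\;\le\;\mathrm{tw}([\![\mathsf A]\!]^{rc}_\Delta)+\mathrm{fb}([\![\mathsf A]\!]^{rc}_\Delta).$$ Moreover, for each c-graph $G$ over $\mathbb{A}^{\mathfrak d}$ and each $k$-generated equivalence relation $\approx$ compatible with $G$, we have $\mathrm{tw}(G_{/\approx})\le\mathrm{tw}(G)+k$. -/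

import Mathlib

namespace SLR

/-! ### Concrete graphs -/

/-- A finite concrete graph (c-graph) of type 0, i.e., without sources, over the set `L` of edge
labels with arities `ar`.  Each edge is attached to a sequence of vertices, whose length is the
arity of the label of the edge. -/
structure CGraph {L : Type*} (ar : L → ℕ) where
  V : Type
  E : Type
  finV : Finite V
  finE : Finite E
  lab : E → L
  edg : E → List V
  edg_length : ∀ e, (edg e).length = ar (lab e)

attribute [instance] CGraph.finV CGraph.finE

/-- No two distinct edges have the same label and the same sequence of vertices. -/
def CGraph.Simple {L : Type*} {ar : L → ℕ} (G : CGraph ar) : Prop :=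
  ∀ e₁ e₂ : G.E, G.lab e₁ = G.lab e₂ → G.edg e₁ = G.edg e₂ → e₁ = e₂

/-- The set of labels extended by the binary disequality label is `Option 𝔸`,
where `none` is the disequality label. -/
def richArity {𝔸 : Type*} (ar : 𝔸 → ℕ) : Option 𝔸 → ℕ
  | none => 2
  | some a => ar a

/-- Deletion of all the edges having the disequality label. -/
def CGraph.proj {𝔸 : Type*} {ar : 𝔸 → ℕ} (G : CGraph (richArity ar)) : CGraph ar where
  V := G.V
  E := {e : G.E // (G.lab e).isSome}
  finV := G.finV
  finE := inferInstance
  lab e := (G.lab e.1).get e.2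
  edg e := G.edg e.1
  edg_length e := by
    have h : G.lab e.1 = some ((G.lab e.1).get e.2) := (Option.some_get e.2).symm
    rw [G.edg_length e.1]
    exact congrArg (richArity ar) h

/-! ### Tree-width -/

/-- A tree decomposition: a finite tree whose nodes carry bags of vertices, such that the vertices
attached to each edge are together in some bag, and the nodes whose bags hold a given vertex form
a non-empty connected subset of the tree. -/
structure TreeDecomposition {L : Type*} {ar : L → ℕ} (G : CGraph ar) where
  N : Type
  finN : Finite N
  tree : SimpleGraph N
  isTree : tree.IsTree
  bag : N → Finset G.V
  edge_mem : ∀ e : G.E, ∃ n, ∀ v ∈ G.edg e, v ∈ bag n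
  connected : ∀ v : G.V, (tree.induce {n | v ∈ bag n}).Connected

/-- The maximal size of a bag, minus one (and zero if all bags are empty). -/
noncomputable def TreeDecomposition.width {L : Type*} {ar : L → ℕ} {G : CGraph ar}
    (D : TreeDecomposition G) : ℕ∞ :=
  ⨆ n : D.N, (((D.bag n).card - 1 : ℕ) : ℕ∞)

/-- The tree-width of a c-graph. -/
noncomputable def CGraph.tw {L : Type*} {ar : L → ℕ} (G : CGraph ar) : ℕ∞ :=
  ⨅ D : TreeDecomposition G, D.width

/-- The tree-width of a set of c-graphs (infinite if unbounded). -/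
noncomputable def setTw {L : Type*} {ar : L → ℕ} (S : Set (CGraph ar)) : ℕ∞ :=
  ⨆ G ∈ S, G.tw

/-! ### Quotients and fusion bounds -/

/-- The quotient of a c-graph by an equivalence relation on its vertices. -/
def CGraph.quotient {L : Type*} {ar : L → ℕ} (G : CGraph ar) (r : Setoid G.V) : CGraph ar where
  V := Quotient r
  E := G.E
  finV := inferInstance
  finE := G.finE
  lab := G.lab
  edg e := (G.edg e).map (Quotient.mk r)
  edg_length e := by rw [List.length_map, G.edg_length]

/-- An equivalence relation is compatible if it neither makes parallel two distinct equally
labelled edges, the disequality edges excepted, nor relates the endpoints of a disequality edge. -/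
structure CGraph.Compatible {𝔸 : Type*} {ar : 𝔸 → ℕ} (G : CGraph (richArity ar))
    (r : Setoid G.V) : Prop where
  edges : ∀ e₁ e₂ : G.E, e₁ ≠ e₂ → G.lab e₁ = G.lab e₂ → G.lab e₁ ≠ none →
    ¬ List.Forall₂ (fun u v => r u v) (G.edg e₁) (G.edg e₂)
  diseq : ∀ (e : G.E) (v₁ v₂ : G.V), G.lab e = none → G.edg e = [v₁, v₂] → ¬ r v₁ v₂

/-- `r` is the least equivalence relation containing the pairs in `S`. -/
def GeneratedBy {V : Type*} (r : Setoid V) (S : Finset (V × V)) : Prop :=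
  IsLeast {t : Setoid V | ∀ p ∈ S, t p.1 p.2} r

/-- `k` is the minimal cardinality of a set of pairs that generates `r`. -/
def IsKGenerated {V : Type*} (r : Setoid V) (k : ℕ) : Prop :=
  IsLeast {n : ℕ | ∃ S : Finset (V × V), S.card = n ∧ GeneratedBy r S} k

/-- The fusion bound of a c-graph: the maximal `k` such that some equivalence relation that is
compatible with `G` is `k`-generated. -/
noncomputable def CGraph.fb {𝔸 : Type*} {ar : 𝔸 → ℕ} (G : CGraph (richArity ar)) : ℕ∞ :=
  ⨆ (k : ℕ) (_ : ∃ r : Setoid G.V, G.Compatible r ∧ IsKGenerated r k), (k : ℕ∞)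

/-- The fusion bound of a set of c-graphs (infinite if unbounded). -/
noncomputable def setFb {𝔸 : Type*} {ar : 𝔸 → ℕ} (S : Set (CGraph (richArity ar))) : ℕ∞ :=
  ⨆ G ∈ S, G.fb

/-! ### Formulas and systems of inductive definitions -/

/-- Equality, disequality and relation atoms with variables in `X`. -/
inductive Atom {𝔸 : Type*} (ar : 𝔸 → ℕ) (X : Type)
  | eq (x y : X)
  | ne (x y : X)
  | rel (a : 𝔸) (xs : Fin (ar a) → X)

/-- Substitution of variables in an atom. -/
def Atom.map {𝔸 : Type*} {ar : 𝔸 → ℕ} {X Y : Type} (f : X → Y) : Atom ar X → Atom ar Y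
  | .eq x y => .eq (f x) (f y)
  | .ne x y => .ne (f x) (f y)
  | .rel a xs => .rel a (fun i => f (xs i))

/-- A quantifier- and predicate-free formula: the separating conjunction of a list of atoms, where
the empty list is `emp`. -/
abbrev QPF {𝔸 : Type*} (ar : 𝔸 → ℕ) (X : Type) := List (Atom ar X)

/-- A rule `B₀(x₁, …, xₙ) ← ∃ y₁ … ∃ yₘ . ψ * B₁(z₁) * … * Bₖ(zₖ)`, where `ψ` is a quantifier- and
predicate-free formula.  The variable `xᵢ` is `Sum.inl i` and `yⱼ` is `Sum.inr j`. -/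
structure Rule {𝔸 : Type*} (ar : 𝔸 → ℕ) {ℙ : Type*} (par : ℙ → ℕ) where
  head : ℙ
  ex : ℕ
  body : QPF ar (Fin (par head) ⊕ Fin ex)
  k : ℕ
  callee : Fin k → ℙ
  actual : (i : Fin k) → Fin (par (callee i)) → Fin (par head) ⊕ Fin ex

section semantics

variable {𝔸 : Type*} {ar : 𝔸 → ℕ} {ℙ : Type*} {par : ℙ → ℕ}

/-- The part of `G` that has the edges `F` satisfies the atom under the store `s`. -/
def AtomSat (G : CGraph ar) {X : Type} (s : X → G.V) (F : Set G.E) : Atom ar X → Prop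
  | .eq x y => F = ∅ ∧ s x = s y
  | .ne x y => F = ∅ ∧ s x ≠ s y
  | .rel a xs => ∃ e, F = {e} ∧ G.lab e = a ∧ G.edg e = List.ofFn (fun i => s (xs i))

/-- The part of `G` that has the edges `F` satisfies the separating conjunction of the atoms:
`F` splits into disjoint parts that satisfy the atoms. -/
def QSat (G : CGraph ar) {X : Type} (s : X → G.V) (F : Set G.E) : QPF ar X → Prop
  | [] => F = ∅
  | a :: φ => ∃ F₁ F₂, F = F₁ ∪ F₂ ∧ Disjoint F₁ F₂ ∧ AtomSat G s F₁ a ∧ QSat G s F₂ φ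

/-- The simple c-graph `G` is a model of `φ` under the store `s` of the variables in `X`, whose
values are all the vertices of `G`. -/
def Models (G : CGraph ar) {X : Type} (s : X → G.V) (φ : QPF ar X) : Prop :=
  G.Simple ∧ Function.Surjective s ∧ QSat G s Set.univ φ

/-- The predicate atoms' semantics: the sub-c-graph of `G` that has the vertices `W` and the edges
`F` satisfies `P(args)`.  This is the least relation such that `P(args)` holds if the right-hand
side of some rule for `P` holds for some values of its existential variables, where the edges are
split by the separating conjunction into disjoint parts, and vertices may be shared.  The vertices
are exactly the values of the variables. -/
inductive PredSat (Δ : Set (Rule ar par)) (G : CGraph ar) :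
    (P : ℙ) → (Fin (par P) → G.V) → Set G.V → Set G.E → Prop
  | unfold (ρ : Rule ar par) (hρ : ρ ∈ Δ) (args : Fin (par ρ.head) → G.V) (ys : Fin ρ.ex → G.V)
      (F₀ : Set G.E) (W : Fin ρ.k → Set G.V) (F : Fin ρ.k → Set G.E)
      (hbody : QSat G (Sum.elim args ys) F₀ ρ.body)
      (hcalls : ∀ i, PredSat Δ G (ρ.callee i)
        (fun j => Sum.elim args ys (ρ.actual i j)) (W i) (F i))
      (hdisj₀ : ∀ i, Disjoint F₀ (F i))
      (hdisj : ∀ i j, i ≠ j → Disjoint (F i) (F j)) :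
      PredSat Δ G ρ.head args (Set.range args ∪ Set.range ys ∪ ⋃ i, W i) (F₀ ∪ ⋃ i, F i)

/-- The `Δ`-models of `A` (for a nullary `A`, the tuple `args` is empty). -/
def sidSem (Δ : Set (Rule ar par)) (A : ℙ) : Set (CGraph ar) :=
  {G | G.Simple ∧ ∃ args : Fin (par A) → G.V, PredSat Δ G A args Set.univ Set.univ}

/-! ### Parse trees and canonical models -/

/-- Parse trees: the unfoldings of a predicate by the rules of `Δ`. -/
inductive ParseTree (Δ : Set (Rule ar par)) : ℙ → Type _
  | node (ρ : Rule ar par) (hρ : ρ ∈ Δ) (children : (i : Fin ρ.k) → ParseTree Δ (ρ.callee i)) :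
      ParseTree Δ ρ.head

/-- The existentially quantified variables of the unfolding: one copy of the existential variables
of a rule for each node of the tree labelled by that rule. -/
def ParseTree.Bound {Δ : Set (Rule ar par)} : {P : ℙ} → ParseTree Δ P → Type
  | _, .node ρ _ ch => Fin ρ.ex ⊕ (Σ i : Fin ρ.k, (ch i).Bound)

/-- The separating conjunction of all atoms of the unfolding, where the parameters of the root
predicate are replaced by `p` and the existential variables are named by `b`. -/
def ParseTree.unfolding {Δ : Set (Rule ar par)} : {P : ℙ} → (T : ParseTree Δ P) → {X : Type} →
    (p : Fin (par P) → X) → (b : T.Bound → X) → QPF ar X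
  | _, .node ρ _ ch, _, p, b =>
    ρ.body.map (Atom.map (Sum.elim p (fun y => b (Sum.inl y)))) ++
      (List.ofFn fun i : Fin ρ.k =>
        (ch i).unfolding (fun j => Sum.elim p (fun y => b (Sum.inl y)) (ρ.actual i j))
          (fun y => b (Sum.inr ⟨i, y⟩))).flatten

/-- The variables of the characteristic formula (for a nullary predicate, only the second summand
is inhabited). -/
abbrev ParseTree.Var {Δ : Set (Rule ar par)} {P : ℙ} (T : ParseTree Δ P) : Type :=
  Fin (par P) ⊕ T.Bound

/-- The characteristic formula of a parse tree. -/
def ParseTree.charForm {Δ : Set (Rule ar par)} {P : ℙ} (T : ParseTree Δ P) : QPF ar T.Var :=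
  T.unfolding Sum.inl Sum.inr

/-- `x = y` is a logical consequence of `φ`. -/
def EntailsEq {X : Type} (φ : QPF ar X) (x y : X) : Prop :=
  ∀ (G : CGraph ar) (s : X → G.V), Models G s φ → s x = s y

/-- The store `s` is canonical for `φ`: it identifies only variables whose equality is a logical
consequence of `φ`. -/
def CanonicalStore {X V : Type} (φ : QPF ar X) (s : X → V) : Prop :=
  ∀ x y, s x = s y → EntailsEq φ x y

/-- The rich canonical `Δ`-models of `A`. -/
def rcSem (Δ : Set (Rule ar par)) (A : ℙ) : Set (CGraph (richArity ar)) :=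
  {G | G.Simple ∧ ∃ (T : ParseTree Δ A) (s : T.Var → G.V),
    CanonicalStore T.charForm s ∧ Models G.proj s T.charForm ∧
    ∀ u v : G.V, (∃ e : G.E, G.lab e = none ∧ G.edg e = [u, v]) ↔
      ∃ x y : T.Var, s x = u ∧ s y = v ∧ Atom.ne x y ∈ T.charForm}

end semantics

end SLR

open SLR

namespace SLR

/-! ### Tree-width of quotients -/

section treewidth

variable {L : Type*} {ar : L → ℕ}

/-! Fusing costs at most one vertex per generating pair. Given a tree decomposition of `G`, replace
vertices by their classes and add the class of each generating pair to every bag. A class that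
contains no such pair is a singleton, so its nodes are unchanged and still connected; the added
classes occupy the whole tree (`TreeDecomposition.quotient`, `CGraph.tw_quotient_le`).

For the bound on models, a model `G` of the predicate yields a parse tree and a store `s` for its
characteristic formula (`exists_models_charForm`). Let `H` have as vertices the variables modulo
entailed equality, with the edges of `G` attached to the variables that name them, plus the
disequality edges. Then `H` is a rich canonical model, `s` factors through its vertices as a
surjection `g`, and `G` is the quotient of `H` by the kernel of `g` up to disequality edges. The
kernel is compatible because `G` is simple and satisfies the disequalities
(`exists_rich_canonical`). It is `k`-generated for some `k`, which is at most the fusion bound of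
`H`. -/

lemma TreeDecomposition.card_le_width {G : CGraph ar} (D : TreeDecomposition G) (n : D.N) :
    (((D.bag n).card - 1 : ℕ) : ℕ∞) ≤ D.width :=
  le_iSup (fun n : D.N => (((D.bag n).card - 1 : ℕ) : ℕ∞)) n

/-- A class of a generated equivalence relation that meets no generating pair is a singleton. -/
lemma GeneratedBy.eq_of_forall_not {V : Type*} {r : Setoid V} {S : Finset (V × V)}
    (h : GeneratedBy r S) {x y : V} (hxy : r x y) (hx : ∀ p ∈ S, ¬ r p.1 x) : x = y := by
  -- `t` splits the class of `x` into singletons and merges everything outside it. It contains `S`,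
  -- hence `r` by minimality.
  let t : Setoid V :=
    { r := fun u v => u = v ∨ (¬ r u x ∧ ¬ r v x)
      iseqv :=
        { refl := fun u => Or.inl rfl
          symm := by
            rintro u v (h | h)
            · exact Or.inl h.symm
            · exact Or.inr h.symm
          trans := by
            rintro u v w (rfl | h) (rfl | h')
            · exact Or.inl rfl
            · exact Or.inr h'
            · exact Or.inr h
            · exact Or.inr ⟨h.1, h'.2⟩ } }
  have ht : r ≤ t := h.2 fun p hp =>
    Or.inr ⟨hx p hp, fun h2 => hx p hp (r.trans' (h.1 p hp) h2)⟩
  rcases ht hxy with h | h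
  · exact h
  · exact absurd (r.refl' x) h.1

/-- The projection to the vertices of a quotient. -/
def CGraph.toQuotient (G : CGraph ar) (r : Setoid G.V) : G.V → (G.quotient r).V :=
  Quotient.mk r

/-- Fusing the classes of an equivalence relation generated by `S`, while adding the fused classes
to all bags. -/
noncomputable def TreeDecomposition.quotient {G : CGraph ar} (D : TreeDecomposition G)
    (r : Setoid G.V) (S : Finset (G.V × G.V)) (h : GeneratedBy r S) :
    TreeDecomposition (G.quotient r) := by
  classical
  exact
  { N := D.N
    finN := D.finN
    tree := D.tree
    isTree := D.isTree
    -- First components suffice: both components of a pair lie in the same class.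
    bag := fun n => (D.bag n).image (G.toQuotient r) ∪ S.image (fun p => G.toQuotient r p.1)
    edge_mem := by
      intro e
      obtain ⟨n, hn⟩ := D.edge_mem e
      refine ⟨n, fun v hv => ?_⟩
      obtain ⟨u, hu, rfl⟩ := List.mem_map.1 hv
      exact Finset.mem_union_left _ (Finset.mem_image_of_mem (G.toQuotient r) (hn u hu))
    connected := by
      intro c
      by_cases hc : c ∈ S.image (fun p => G.toQuotient r p.1)
      · have : {n | c ∈ (D.bag n).image (G.toQuotient r) ∪ S.image (fun p => G.toQuotient r p.1)}
            = Set.univ := Set.eq_univ_of_forall fun n => Finset.mem_union_right _ hc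
        rw [this]
        exact (SimpleGraph.induceUnivIso D.tree).connected_iff.2 D.isTree.1
      · obtain ⟨v, rfl⟩ : ∃ v, G.toQuotient r v = c := Quotient.exists_rep c
        have : {n | G.toQuotient r v ∈
            (D.bag n).image (G.toQuotient r) ∪ S.image (fun p => G.toQuotient r p.1)}
            = {n | v ∈ D.bag n} := by
          ext n
          constructor
          · intro hn
            rcases Finset.mem_union.1 hn with hn | hn
            · obtain ⟨u, hu, huv⟩ := Finset.mem_image.1 hn
              have hvu : v = u := h.eq_of_forall_not (r.symm' (Quotient.exact huv))
                fun p hp hpv => hc (Finset.mem_image.2 ⟨p, hp, Quotient.sound hpv⟩)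
              exact hvu ▸ hu
            · exact absurd hn hc
          · intro hn
            exact Finset.mem_union_left _ (Finset.mem_image_of_mem _ hn)
        rw [this]
        exact D.connected v }

lemma TreeDecomposition.width_quotient_le {G : CGraph ar} (D : TreeDecomposition G)
    (r : Setoid G.V) (S : Finset (G.V × G.V)) (h : GeneratedBy r S) :
    (D.quotient r S h).width ≤ D.width + (S.card : ℕ∞) := by
  classical
  refine iSup_le fun n => ?_
  refine le_trans ?_ (add_le_add_left (D.card_le_width n) _)
  have h1 : ((D.quotient r S h).bag n).card ≤ (D.bag n).card + S.card :=
    (Finset.card_union_le _ _).trans (add_le_add Finset.card_image_le Finset.card_image_le)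
  -- Subtraction is truncated; the inequality also holds for an empty bag.
  exact_mod_cast (by omega :
    ((D.quotient r S h).bag n).card - 1 ≤ (D.bag n).card - 1 + S.card)

/-- `ℕ∞` is well-ordered, so a non-empty infimum is attained. -/
lemma CGraph.exists_width_eq_tw (G : CGraph ar) [Nonempty (TreeDecomposition G)] :
    ∃ D : TreeDecomposition G, D.width = G.tw :=
  ciInf_mem (fun D : TreeDecomposition G => D.width)

/-- Fusing the classes of a `k`-generated equivalence relation raises the tree-width by at most
`k`. -/
lemma CGraph.tw_quotient_le (G : CGraph ar) (r : Setoid G.V) (k : ℕ) (h : IsKGenerated r k) :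
    (G.quotient r).tw ≤ G.tw + (k : ℕ∞) := by
  obtain ⟨S, rfl, hS⟩ := h.1
  rcases isEmpty_or_nonempty (TreeDecomposition G) with hE | hE
  · have : G.tw = ⊤ := iInf_of_empty _
    simp [this]
  · obtain ⟨D, hD⟩ := G.exists_width_eq_tw
    rw [← hD]
    exact (iInf_le _ (D.quotient r S hS)).trans (D.width_quotient_le r S hS)

/-- Tree-width does not grow along a bijection of the vertices under which each edge of the target
is covered by an edge of the source. -/
lemma CGraph.tw_le_of_equiv {L' : Type*} {ar' : L' → ℕ} (G : CGraph ar) (H : CGraph ar')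
    (f : H.V ≃ G.V) (hf : ∀ e : G.E, ∃ e' : H.E, G.edg e = (H.edg e').map f) :
    G.tw ≤ H.tw := by
  refine le_iInf fun D => ?_
  let D' : TreeDecomposition G :=
    { N := D.N
      finN := D.finN
      tree := D.tree
      isTree := D.isTree
      bag := fun n => (D.bag n).map f.toEmbedding
      edge_mem := by
        intro e
        obtain ⟨e', he'⟩ := hf e
        obtain ⟨n, hn⟩ := D.edge_mem e'
        refine ⟨n, fun v hv => ?_⟩
        rw [he'] at hv
        obtain ⟨u, hu, rfl⟩ := List.mem_map.1 hv
        exact Finset.mem_map_of_mem f.toEmbedding (hn u hu)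
      connected := by
        intro v
        have : {n | v ∈ (D.bag n).map f.toEmbedding} = {n | f.symm v ∈ D.bag n} := by
          ext n
          exact Finset.mem_map_equiv
        rw [this]
        exact D.connected _ }
  refine (iInf_le _ D').trans (iSup_le fun n => ?_)
  have : (D'.bag n).card = (D.bag n).card := Finset.card_map _
  rw [this]
  exact D.card_le_width n

/-- Every equivalence relation on a finite set is `k`-generated for some `k`. -/
lemma exists_isKGenerated {V : Type*} [Finite V] (r : Setoid V) : ∃ k, IsKGenerated r k := by
  classical
  have hne : {n : ℕ | ∃ S : Finset (V × V), S.card = n ∧ GeneratedBy r S}.Nonempty := by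
    have := Fintype.ofFinite V
    refine ⟨_, Finset.univ.filter (fun p : V × V => r p.1 p.2), rfl, ?_, ?_⟩
    · intro p hp
      exact (Finset.mem_filter.1 hp).2
    · intro t ht x y hxy
      exact ht (x, y) (Finset.mem_filter.2 ⟨Finset.mem_univ _, hxy⟩)
  exact ⟨_, Nat.sInf_mem hne, fun n hn => Nat.sInf_le hn⟩

end treewidth

/-! ### Satisfaction of separating conjunctions -/

section satisfaction

variable {𝔸 : Type*} {ar : 𝔸 → ℕ} {ℙ : Type*} {par : ℙ → ℕ}

lemma atomSat_map {G : CGraph ar} {X Y : Type} (f : X → Y) (s : Y → G.V) (F : Set G.E)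
    (a : Atom ar X) : AtomSat G s F (a.map f) ↔ AtomSat G (s ∘ f) F a := by
  cases a <;> rfl

lemma qsat_map {G : CGraph ar} {X Y : Type} (f : X → Y) (s : Y → G.V) (φ : QPF ar X) :
    ∀ F : Set G.E, QSat G s F (φ.map (Atom.map f)) ↔ QSat G (s ∘ f) F φ := by
  induction φ with
  | nil => intro F; rfl
  | cons a φ ih =>
    intro F
    simp only [List.map_cons, QSat, atomSat_map, ih]

lemma QSat.append {G : CGraph ar} {X : Type} {s : X → G.V} {φ ψ : QPF ar X} :
    ∀ {F₁ F₂ : Set G.E}, QSat G s F₁ φ → QSat G s F₂ ψ → Disjoint F₁ F₂ →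
      QSat G s (F₁ ∪ F₂) (φ ++ ψ) := by
  induction φ with
  | nil =>
    intro F₁ F₂ h₁ h₂ _
    have h₁ : F₁ = ∅ := h₁
    simpa [h₁] using h₂
  | cons a φ ih =>
    rintro F₁ F₂ ⟨A, B, rfl, hAB, ha, hB⟩ h₂ hd
    rw [Set.disjoint_union_left] at hd
    exact ⟨A, B ∪ F₂, Set.union_assoc _ _ _, Set.disjoint_union_right.2 ⟨hAB, hd.1⟩, ha,
      ih hB h₂ hd.2⟩

lemma qsat_flatten_ofFn {G : CGraph ar} {X : Type} {s : X → G.V} :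
    ∀ {n : ℕ} {φ : Fin n → QPF ar X} {F : Fin n → Set G.E}, (∀ i, QSat G s (F i) (φ i)) →
      (∀ i j, i ≠ j → Disjoint (F i) (F j)) → QSat G s (⋃ i, F i) (List.ofFn φ).flatten := by
  intro n
  induction n with
  | zero =>
    intro φ F _ _
    simp [QSat]
  | succ n ih =>
    intro φ F h hd
    rw [List.ofFn_succ, List.flatten_cons]
    have hU : (⋃ i, F i) = F 0 ∪ ⋃ i : Fin n, F i.succ := by
      ext e
      simp [Fin.exists_fin_succ]
    rw [hU]
    refine (h 0).append (ih (fun i => h i.succ) fun i j hij => hd _ _ ?_) ?_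
    · exact fun hs => hij (Fin.succ_injective _ hs)
    · exact Set.disjoint_iUnion_right.2 fun i => hd _ _ (Fin.succ_ne_zero i).symm

lemma QSat.eq_of_mem {G : CGraph ar} {X : Type} {s : X → G.V} {φ : QPF ar X} {x y : X}
    (hm : Atom.eq x y ∈ φ) : ∀ {F : Set G.E}, QSat G s F φ → s x = s y := by
  induction φ with
  | nil => simp at hm
  | cons a φ ih =>
    rintro F ⟨A, B, -, -, ha, hB⟩
    rcases List.mem_cons.1 hm with rfl | hm
    · exact ha.2
    · exact ih hm hB

lemma QSat.ne_of_mem {G : CGraph ar} {X : Type} {s : X → G.V} {φ : QPF ar X} {x y : X}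
    (hm : Atom.ne x y ∈ φ) : ∀ {F : Set G.E}, QSat G s F φ → s x ≠ s y := by
  induction φ with
  | nil => simp at hm
  | cons a φ ih =>
    rintro F ⟨A, B, -, -, ha, hB⟩
    rcases List.mem_cons.1 hm with rfl | hm
    · exact ha.2
    · exact ih hm hB

/-- A model of `φ` names the vertices attached to its edges by variables; any c-graph with the
same edges, attached according to these names, is again a model, if its store respects the
equalities and disequalities in `φ`. -/
lemma QSat.exists_vars {G : CGraph ar} {X : Type} {s : X → G.V} {φ : QPF ar X} :
    ∀ {F : Set G.E}, QSat G s F φ → ∃ vars : G.E → List X,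
      (∀ e ∈ F, G.edg e = (vars e).map s) ∧
      ∀ (H : CGraph ar) (f : H.E ≃ G.E) (t : X → H.V), (∀ e, H.lab e = G.lab (f e)) →
        (∀ e, f e ∈ F → H.edg e = (vars (f e)).map t) →
        (∀ x y, Atom.eq x y ∈ φ → t x = t y) → (∀ x y, Atom.ne x y ∈ φ → t x ≠ t y) →
        QSat H t (f ⁻¹' F) φ := by
  classical
  induction φ with
  | nil =>
    intro F hF
    have hF : F = ∅ := hF
    subst hF
    exact ⟨fun _ => [], by simp, fun H f t _ _ _ _ => Set.preimage_empty⟩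
  | cons a φ ih =>
    rintro F ⟨A, B, rfl, hAB, ha, hB⟩
    obtain ⟨vars, hv, hφ⟩ := ih hB
    cases a with
    | eq x y =>
      obtain ⟨rfl, -⟩ := ha
      refine ⟨vars, fun e he => hv e (by simpa using he), fun H f t hl he heq hne => ?_⟩
      exact ⟨∅, f ⁻¹' B, by simp, Set.empty_disjoint _, ⟨rfl, heq _ _ (by simp)⟩,
        hφ H f t hl (fun e h => he e (Or.inr h)) (fun x y h => heq x y (List.mem_cons_of_mem _ h))
          (fun x y h => hne x y (List.mem_cons_of_mem _ h))⟩
    | ne x y =>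
      obtain ⟨rfl, -⟩ := ha
      refine ⟨vars, fun e he => hv e (by simpa using he), fun H f t hl he heq hne => ?_⟩
      exact ⟨∅, f ⁻¹' B, by simp, Set.empty_disjoint _, ⟨rfl, hne _ _ (by simp)⟩,
        hφ H f t hl (fun e h => he e (Or.inr h)) (fun x y h => heq x y (List.mem_cons_of_mem _ h))
          (fun x y h => hne x y (List.mem_cons_of_mem _ h))⟩
    | rel a xs =>
      obtain ⟨e₀, rfl, hlab, hedg⟩ := ha
      -- By disjointness, naming the vertices of `e₀` leaves the names already chosen on `B` intact.
      have hB₀ : ∀ e ∈ B, e ≠ e₀ := fun e he h => Set.disjoint_left.1 hAB h he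
      refine ⟨Function.update vars e₀ (List.ofFn xs), ?_, fun H f t hl he heq hne => ?_⟩
      · rintro e (rfl | he)
        · rw [Function.update_self, List.map_ofFn, hedg]
          rfl
        · rw [Function.update_of_ne (hB₀ e he), hv e he]
      · refine ⟨f ⁻¹' {e₀}, f ⁻¹' B, rfl, hAB.preimage f, ⟨f.symm e₀, ?_, ?_, ?_⟩,
          hφ H f t hl (fun e h => ?_) (fun x y h => heq x y (List.mem_cons_of_mem _ h))
            (fun x y h => hne x y (List.mem_cons_of_mem _ h))⟩
        · ext e
          simp [Equiv.eq_symm_apply]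
        · rw [hl, Equiv.apply_symm_apply, hlab]
        · rw [he _ (by simp), Equiv.apply_symm_apply, Function.update_self, List.map_ofFn]
          rfl
        · rw [he e (Or.inr h), Function.update_of_ne (hB₀ _ h)]

/-! ### Parse trees of models -/

instance ParseTree.finite_bound {Δ : Set (Rule ar par)} {P : ℙ} (T : ParseTree Δ P) :
    Finite T.Bound := by
  induction T with
  | node ρ hρ ch ih =>
    have := ih
    exact inferInstanceAs (Finite (Fin ρ.ex ⊕ (Σ i : Fin ρ.k, (ch i).Bound)))

lemma Atom.map_map {X Y Z : Type} (f : X → Y) (g : Y → Z) (a : Atom ar X) :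
    (a.map f).map g = a.map (g ∘ f) := by
  cases a <;> rfl

lemma ParseTree.map_unfolding {Δ : Set (Rule ar par)} {P : ℙ} (T : ParseTree Δ P) :
    ∀ {X Y : Type} (f : X → Y) (p : Fin (par P) → X) (b : T.Bound → X),
      (T.unfolding p b).map (Atom.map f) = T.unfolding (f ∘ p) (f ∘ b) := by
  induction T with
  | node ρ hρ ch ih =>
    intro X Y f p b
    have hs : f ∘ Sum.elim p (fun y => b (Sum.inl y)) =
        Sum.elim (f ∘ p) (fun y => (f ∘ b) (Sum.inl y)) := Sum.comp_elim ..
    simp only [ParseTree.unfolding, List.map_append, List.map_map, List.map_flatten,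
      List.map_ofFn]
    congr 1
    · refine List.map_congr_left fun a _ => ?_
      rw [Function.comp_apply, Atom.map_map, hs]
    · congr 2
      funext i
      rw [Function.comp_apply, ih, ← hs]
      rfl

/-- The vertices of `G` themselves serve as variables, under the store `id`; thus the unfoldings of
the children combine without any renaming. -/
lemma PredSat.exists_parseTree {Δ : Set (Rule ar par)} {G : CGraph ar} {P : ℙ}
    {args : Fin (par P) → G.V} {W : Set G.V} {F : Set G.E} (h : PredSat Δ G P args W F) :
    ∃ (T : ParseTree Δ P) (b : T.Bound → G.V),
      W = Set.range args ∪ Set.range b ∧ QSat G id F (T.unfolding args b) := by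
  induction h with
  | unfold ρ hρ args ys F₀ W F hbody hcalls hdisj₀ hdisj ih =>
    choose ch b hW hQ using ih
    let b' : (ParseTree.node ρ hρ ch).Bound → G.V :=
      fun z : Fin ρ.ex ⊕ (Σ i : Fin ρ.k, (ch i).Bound) => Sum.elim ys (fun y => b y.1 y.2) z
    refine ⟨.node ρ hρ ch, b', ?_, ?_⟩
    · have hb' : Set.range b' = Set.range ys ∪ ⋃ i, Set.range (b i) := by
        ext v
        constructor
        · rintro ⟨z | ⟨i, z⟩, rfl⟩
          · exact Or.inl ⟨z, rfl⟩
          · exact Or.inr (Set.mem_iUnion.2 ⟨i, z, rfl⟩)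
        · rintro (⟨z, rfl⟩ | hv)
          · exact ⟨Sum.inl z, rfl⟩
          · obtain ⟨i, z, rfl⟩ := Set.mem_iUnion.1 hv
            exact ⟨Sum.inr ⟨i, z⟩, rfl⟩
      rw [hb', ← Set.union_assoc]
      apply subset_antisymm
      · refine Set.union_subset Set.subset_union_left (Set.iUnion_subset fun i => ?_)
        rw [hW]
        refine Set.union_subset ?_ ?_
        -- Actual parameters are variables of the rule, so they contribute no new vertex.
        · rintro _ ⟨j, rfl⟩
          refine Or.inl ?_
          beta_reduce
          rcases ρ.actual i j with z | z
          · exact Or.inl ⟨z, rfl⟩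
          · exact Or.inr ⟨z, rfl⟩
        · exact fun v hv => Or.inr (Set.mem_iUnion.2 ⟨i, hv⟩)
      · refine Set.union_subset_union_right _ (Set.iUnion_mono fun i => ?_)
        rw [hW]
        exact Set.subset_union_right
    · refine QSat.append ?_ (qsat_flatten_ofFn hQ hdisj) (Set.disjoint_iUnion_right.2 hdisj₀)
      exact (qsat_map _ _ _ _).2 hbody

/-- Each model of a predicate is a model of the characteristic formula of some parse tree. -/
lemma exists_models_charForm {Δ : Set (Rule ar par)} {A : ℙ} {G : CGraph ar}
    (h : G ∈ sidSem Δ A) : ∃ (T : ParseTree Δ A) (s : T.Var → G.V), Models G s T.charForm := by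
  obtain ⟨hG, args, hP⟩ := h
  obtain ⟨T, b, hW, hQ⟩ := hP.exists_parseTree
  refine ⟨T, Sum.elim args b, hG, ?_, ?_⟩
  · rw [← Set.range_eq_univ, Set.Sum.elim_range]
    exact hW.symm
  -- Renaming along the store turns the characteristic formula into the unfolding over vertices.
  · have := qsat_map (G := G) (Sum.elim args b) id T.charForm Set.univ
    rw [Function.id_comp] at this
    rw [← this, ParseTree.charForm, ParseTree.map_unfolding]
    exact hQ

/-! ### Rich canonical models -/

/-- The equivalence of variables whose equality is a logical consequence of `φ`. -/
def entailedSetoid {X : Type} (φ : QPF ar X) : Setoid X where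
  r := EntailsEq φ
  iseqv :=
    { refl := fun _ _ _ _ => rfl
      symm := fun h G s hM => (h G s hM).symm
      trans := fun h h' G s hM => (h G s hM).trans (h' G s hM) }

/-- The pairs of classes of variables between which `φ` has a disequality atom. -/
abbrev DiseqPair {X : Type} (φ : QPF ar X) : Type :=
  {p : Quotient (entailedSetoid φ) × Quotient (entailedSetoid φ) //
    ∃ x y, (Quotient.mk _ x, Quotient.mk _ y) = p ∧ Atom.ne x y ∈ φ}

/-- The c-graph on the classes of variables of `φ` that has the edges of `G`, attached to the
variables `vars`, and a disequality edge for each disequality atom. -/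
def richGraph {X : Type} [Finite X] (φ : QPF ar X) (G : CGraph ar) (vars : G.E → List X)
    (hvars : ∀ e, (vars e).length = ar (G.lab e)) : CGraph (richArity ar) where
  V := Quotient (entailedSetoid φ)
  E := G.E ⊕ DiseqPair φ
  finV := inferInstance
  finE := inferInstance
  lab := Sum.elim (fun e => some (G.lab e)) (fun _ => none)
  edg := Sum.elim (fun e => (vars e).map (Quotient.mk _)) (fun p => [p.1.1, p.1.2])
  edg_length := by
    rintro (e | p)
    · simp [hvars, richArity]
    · rfl

/-- Each model is a compatible quotient of a rich canonical model, up to disequality edges. -/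
lemma exists_rich_canonical {Δ : Set (Rule ar par)} {A : ℙ} {G : CGraph ar}
    (h : G ∈ sidSem Δ A) : ∃ H ∈ rcSem Δ A, ∃ r : Setoid H.V, H.Compatible r ∧
      G.tw ≤ (H.quotient r).tw := by
  obtain ⟨T, s, hM⟩ := exists_models_charForm h
  obtain ⟨hG, hs, hQ⟩ := hM
  have hM : Models G s T.charForm := ⟨hG, hs, hQ⟩
  obtain ⟨vars, hv, hφ⟩ := hQ.exists_vars
  have hv : ∀ e, G.edg e = (vars e).map s := fun e => hv e trivial
  let H := richGraph T.charForm G vars fun e => by rw [← G.edg_length, hv, List.length_map]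
  let q : T.Var → H.V := Quotient.mk (entailedSetoid T.charForm)
  -- Well defined because `G` is itself a model, so entailed equalities hold under `s`.
  let g : H.V → G.V := Quotient.lift s fun x y hxy => hxy G s hM
  have hgq : g ∘ q = s := rfl
  have hedg : ∀ e : G.E, (H.edg (Sum.inl e)).map g = G.edg e := fun e => by
    rw [hv e, ← hgq, ← List.map_map]
    rfl
  have hg : Function.Surjective g := fun v => by
    obtain ⟨x, rfl⟩ := hs v
    exact ⟨q x, rfl⟩
  refine ⟨H, ⟨?_, T, q, fun x y hxy => Quotient.exact hxy, ⟨?_, Quotient.mk_surjective, ?_⟩, ?_⟩,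
    Setoid.ker g, ⟨?_, ?_⟩, ?_⟩
  -- Parallel edges of `H` would be parallel in `G` after applying `g`. Disequality edges are
  -- indexed by pairs of classes, not by atoms, so none are parallel.
  · rintro (e₁ | p₁) (e₂ | p₂) hl he
    · rw [hG e₁ e₂ (Option.some_injective _ hl) (by rw [← hedg, ← hedg, he])]
    · cases hl
    · cases hl
    · have he : [p₁.1.1, p₁.1.2] = [p₂.1.1, p₂.1.2] := he
      simp only [List.cons.injEq, and_true] at he
      exact congrArg Sum.inr (Subtype.ext (Prod.ext he.1 he.2))
  · rintro ⟨e₁ | p₁, h₁⟩ ⟨e₂ | p₂, h₂⟩ hl he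
    · have := hG e₁ e₂ hl (by rw [← hedg, ← hedg]; exact congrArg (List.map g) he)
      subst this
      rfl
    · cases h₂
    · cases h₁
    · cases h₁
  · let f : H.proj.E ≃ G.E :=
      { toFun := fun e => match e with
          | ⟨Sum.inl e, _⟩ => e
          | ⟨Sum.inr _, h⟩ => absurd h Bool.false_ne_true
        invFun := fun e => ⟨Sum.inl e, rfl⟩
        left_inv := by
          rintro ⟨e | p, h⟩
          · rfl
          · cases h
        right_inv := fun e => rfl }
    refine hφ H.proj f q ?_ ?_ ?_ ?_
    · rintro ⟨e | p, h⟩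
      · rfl
      · cases h
    · rintro ⟨e | p, h⟩ -
      · rfl
      · cases h
    · intro x y hxy
      exact Quotient.sound fun G' s' hM' => hM'.2.2.eq_of_mem hxy
    · intro x y hxy hq
      -- Identifying `x` and `y` in `H` would identify them in `G`.
      exact hQ.ne_of_mem hxy (congrArg g hq)
  · intro u v
    constructor
    · rintro ⟨e | ⟨_, x, y, rfl, hxy⟩, hl, he⟩
      · cases hl
      · have he : [q x, q y] = [u, v] := he
        simp only [List.cons.injEq, and_true] at he
        exact ⟨x, y, he.1, he.2, hxy⟩
    · rintro ⟨x, y, rfl, rfl, hxy⟩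
      exact ⟨Sum.inr ⟨(q x, q y), x, y, rfl, hxy⟩, rfl, rfl⟩
  · rintro (e₁ | p₁) (e₂ | p₂) hne hl hnone hF
    · refine hne (congrArg Sum.inl (hG e₁ e₂ (Option.some_injective _ hl) ?_))
      -- Componentwise equivalence under the kernel of `g` is equality of the images under `g`.
      rw [← hedg, ← hedg, ← List.forall₂_eq_eq_eq, List.forall₂_map_left_iff,
        List.forall₂_map_right_iff]
      exact hF
    · cases hl
    · cases hl
    · exact hnone rfl
  · rintro (e | ⟨_, x, y, rfl, hxy⟩) v₁ v₂ hl he hr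
    · cases hl
    · have he : [q x, q y] = [v₁, v₂] := he
      simp only [List.cons.injEq, and_true] at he
      obtain ⟨rfl, rfl⟩ := he
      exact hQ.ne_of_mem hxy hr
  -- Only edges of `G` need covering; the disequality edges of the quotient are extra.
  · refine G.tw_le_of_equiv (H.quotient (Setoid.ker g))
      (Setoid.quotientKerEquivOfSurjective g hg) fun e => ⟨Sum.inl e, ?_⟩
    rw [← hedg]
    simp only [CGraph.quotient, List.map_map]
    rfl

end satisfaction

end SLR

open SLR
theorem mainTheorem3 {𝔸 : Type*} (ar : 𝔸 → ℕ) {ℙ : Type*} (par : ℙ → ℕ)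
    (Δ : Set (Rule ar par)) (A : ℙ) (hA : par A = 0) :
    setTw (sidSem Δ A) ≤ setTw (rcSem Δ A) + setFb (rcSem Δ A) ∧
    ∀ (G : CGraph (richArity ar)) (r : Setoid G.V) (k : ℕ),
      G.Compatible r → IsKGenerated r k → (G.quotient r).tw ≤ G.tw + (k : ℕ∞) := by
  refine ⟨iSup₂_le fun G hG => ?_, fun G r k _ hk => G.tw_quotient_le r k hk⟩
  obtain ⟨H, hH, r, hr, htw⟩ := exists_rich_canonical hG
  obtain ⟨k, hk⟩ := exists_isKGenerated r
  have hfb : (k : ℕ∞) ≤ H.fb :=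
    le_iSup₂ (f := fun (k : ℕ) (_ : ∃ r : Setoid H.V, H.Compatible r ∧ IsKGenerated r k) =>
      (k : ℕ∞)) k ⟨r, hr, hk⟩
  refine htw.trans ((H.tw_quotient_le r k hk).trans (add_le_add ?_ (hfb.trans ?_)))
  · exact le_iSup₂ (f := fun (G : CGraph (richArity ar)) (_ : G ∈ rcSem Δ A) => G.tw) H hH
  · exact le_iSup₂ (f := fun (G : CGraph (richArity ar)) (_ : G ∈ rcSem Δ A) => G.fb) H hH
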